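/- Let $(R,\mathfrak m)$ be a commutative Noetherian local ring and let $M$ be a finitely generated $R$-module of (Krull) dimension $d=\dim M\ge 1$. Let $\mathfrak q=(x_1,\dots,x_d)R$ be an ideal generated by a system of parameters on $M$, i.e. by elements $x_1,\dots,x_d\in\mathfrak m$ such that $M/(x_1,\dots,x_d)M$ has finite length, and put $c=\ell_R(M/\mathfrak qM)$. Then every submodule $N$ of $M$ with $\operatorname{depth}(M/N)\ge d-1$ satisfies $\mu(N)\le c$. Here $\mu(N)$ is the minimal number of generators of $N$, $\ell_R$ denotes length, and the depth of a nonzero finitely generated module is the supremum of the lengths of the regular sequences on it contained in $\mathfrak m$, with $\operatorname{depth}(0)=\infty$. -/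

import Mathlib

open Classical in
/-- The depth of a module `M` over a local ring `R`: the supremum of the lengths of the `M`-regular
sequences contained in the maximal ideal, with the convention that the zero module has depth `∞`
(the supremum is taken in `ℕ∞`; the empty sequence is regular on every nonzero module). -/
noncomputable def moduleDepth (R : Type*) [CommRing R] [IsLocalRing R]
    (M : Type*) [AddCommGroup M] [Module R M] : ℕ∞ :=
  if Subsingleton M then ⊤
  else ⨆ (rs : List R) (_ : (∀ r ∈ rs, r ∈ IsLocalRing.maximalIdeal R) ∧
    RingTheory.Sequence.IsRegular M rs), (rs.length : ℕ∞)

/-- `x₁, …, xₙ` is a system of parameters on the module `M` over the local ring `R`: the number `n`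
of elements is the dimension of `M`, the elements lie in the maximal ideal, and
`M / (x₁, …, xₙ) M` has finite length. -/
structure IsSystemOfParameters (R : Type*) [CommRing R] [IsLocalRing R]
    (M : Type*) [AddCommGroup M] [Module R M] {n : ℕ} (x : Fin n → R) : Prop where
  supportDim_eq : Module.supportDim R M = n
  mem_maximalIdeal : ∀ i, x i ∈ IsLocalRing.maximalIdeal R
  isFiniteLength :
    IsFiniteLength R (M ⧸ (Ideal.span (Set.range x) • (⊤ : Submodule R M)))

open Pointwise RingTheory.Sequence IsLocalRing

/-! Induct on the number of parameters. For one parameter x, Nakayama gives μ(N) ≤ ℓ(N/xN), and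
ℓ(N/xN) ≤ ℓ(M/xM): the kernel of N/xN → M/xM is a quotient of the kernel of x on M/N, which is at
most as long as the cokernel.

With more parameters, M/N has positive depth, so no associated prime of M/N contains the parameter
ideal. Prime avoidance on a coset changes x₁ by a combination of the others into y regular on M/N;
the ideal is unchanged. Then N ∩ yM = yN, so μ(N) is at most μ of the image of N in M/yM, whose
quotient (M/N)/y(M/N) has lost at most one from its depth.

Weakly regular sequences replace depth, so that N = M needs no separate case. -/

/-- Prime avoidance for a coset `x + J`. -/
theorem Ideal.exists_add_notMem_of_forall_isPrime {R : Type*} [CommRing R] (x : R) (J : Ideal R)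
    (S : Finset (Ideal R)) (hS : ∀ P ∈ S, P.IsPrime) (h : ∀ P ∈ S, x ∈ P → ¬ J ≤ P) :
    ∃ j ∈ J, ∀ P ∈ S, x + j ∉ P := by
  classical
  induction S using Finset.strongInduction with
  | H S ih =>
    rcases S.eq_empty_or_nonempty with rfl | hne
    · exact ⟨0, J.zero_mem, by simp⟩
    -- Minimality of P keeps every other prime of S from lying inside P, so some t ∈ J avoids P but
    -- lies in all the others.
    obtain ⟨P, hP⟩ := S.exists_minimal hne
    have hPS := hP.prop
    obtain ⟨j, hj, hjS⟩ := ih (S.erase P) (Finset.erase_ssubset hPS)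
      (fun Q hQ ↦ hS Q (Finset.mem_of_mem_erase hQ)) (fun Q hQ ↦ h Q (Finset.mem_of_mem_erase hQ))
    by_cases hxj : x + j ∈ P
    · have hJP : ¬ J ≤ P := fun hle ↦ h P hPS
        (by simpa using P.sub_mem hxj (hle hj)) hle
      have := hS P hPS
      have hinf : ¬ J ⊓ (S.erase P).inf id ≤ P := by
        rw [Ideal.IsPrime.inf_le this, Ideal.IsPrime.inf_le' this]
        rintro (hle | ⟨Q, hQ, hle⟩)
        · exact hJP hle
        · exact (Finset.ne_of_mem_erase hQ)
            (le_antisymm hle (hP.le_of_le (Finset.mem_of_mem_erase hQ) hle))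
      obtain ⟨t, ht, htP⟩ := SetLike.not_le_iff_exists.mp hinf
      refine ⟨j + t, J.add_mem hj ht.1, fun Q hQ hmem ↦ ?_⟩
      rw [← add_assoc] at hmem
      by_cases hQP : Q = P
      · subst hQP
        exact htP (by simpa using Q.sub_mem hmem hxj)
      · have hQ' := Finset.mem_erase.mpr ⟨hQP, hQ⟩
        have htQ : t ∈ Q := (Finset.inf_le (f := id) hQ') ht.2
        exact hjS Q hQ' (by simpa using Q.sub_mem hmem htQ)
    · refine ⟨j, hj, fun Q hQ ↦ ?_⟩
      by_cases hQP : Q = P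
      · exact hQP ▸ hxj
      · exact hjS Q (Finset.mem_erase.mpr ⟨hQP, hQ⟩)

theorem exists_isSMulRegular_add {R : Type*} [CommRing R] [IsNoetherianRing R]
    {M : Type*} [AddCommGroup M] [Module R M] [Module.Finite R M] (x : R) (J : Ideal R)
    (h : ∀ P ∈ associatedPrimes R M, x ∈ P → ¬ J ≤ P) :
    ∃ j ∈ J, IsSMulRegular M (x + j) := by
  have hfin := associatedPrimes.finite R M
  obtain ⟨j, hj, hjS⟩ := Ideal.exists_add_notMem_of_forall_isPrime x J hfin.toFinset
    (fun P hP ↦ IsAssociatedPrime.isPrime (hfin.mem_toFinset.mp hP))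
    (fun P hP ↦ h P (hfin.mem_toFinset.mp hP))
  refine ⟨j, hj, ?_⟩
  by_contra hreg
  have : x + j ∈ ⋃ p ∈ associatedPrimes R M, (p : Set R) := by
    rw [biUnion_associatedPrimes_eq_compl_regular]
    exact hreg
  obtain ⟨P, hP, hmem⟩ := Set.mem_iUnion₂.mp this
  exact hjS P (hfin.mem_toFinset.mpr hP) hmem

/-- The socles of `M / aM` and `M / bM` with respect to an ideal vanish simultaneously. -/
theorem QuotSMulTop.eq_zero_of_forall_smul_eq_zero {R M : Type*} [CommRing R] [AddCommGroup M] [Module R M]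
    {I : Ideal R} {a b : R} (ha : IsSMulRegular M a) (hb : IsSMulRegular M b) (haI : a ∈ I)
    (h : ∀ u : QuotSMulTop a M, (∀ r ∈ I, r • u = 0) → u = 0)
    (u : QuotSMulTop b M) (hu : ∀ r ∈ I, r • u = 0) : u = 0 := by
  obtain ⟨u, rfl⟩ := Submodule.Quotient.mk_surjective _ u
  have hu' : ∀ r ∈ I, ∃ w, b • w = r • u := fun r hr ↦ by
    have := hu r hr
    rw [← Submodule.Quotient.mk_smul, Submodule.Quotient.mk_eq_zero,
      Submodule.mem_smul_pointwise_iff_exists] at this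
    obtain ⟨w, -, hw⟩ := this
    exact ⟨w, hw⟩
  -- The relation a • u = b • v carries a socle class of M/bM to one of M/aM.
  obtain ⟨v, hv⟩ := hu' a haI
  have hv0 : (Submodule.Quotient.mk v : QuotSMulTop a M) = 0 := h _ fun r hr ↦ by
    obtain ⟨w, hw⟩ := hu' r hr
    rw [← Submodule.Quotient.mk_smul, Submodule.Quotient.mk_eq_zero,
      Submodule.mem_smul_pointwise_iff_exists]
    refine ⟨w, trivial, hb ?_⟩
    change b • a • w = b • r • v
    rw [smul_comm b a, hw, smul_comm b r, hv, smul_comm]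
  rw [Submodule.Quotient.mk_eq_zero, Submodule.mem_smul_pointwise_iff_exists] at hv0 ⊢
  obtain ⟨v', -, hv'⟩ := hv0
  refine ⟨v', trivial, ha ?_⟩
  change a • b • v' = a • u
  rw [smul_comm, hv', hv]

theorem IsSMulRegular.eq_zero_of_forall_mem_smul {R M : Type*} [CommRing R] [AddCommGroup M] [Module R M]
    {I : Ideal R} {a : R} (ha : IsSMulRegular M a) (haI : a ∈ I) (u : M)
    (hu : ∀ r ∈ I, r • u = 0) : u = 0 :=
  ha.right_eq_zero_of_smul (hu a haI)

/-! ### Depth modulo a regular element -/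

section Depth

variable {R : Type*} [CommRing R] [IsLocalRing R] [IsNoetherianRing R]

/-- A zero socle means Hom(R/𝔪, M) = 0, which forces an M-regular element in 𝔪. -/
theorem exists_isSMulRegular_mem_maximalIdeal {M : Type*} [AddCommGroup M] [Module R M]
    [Module.Finite R M] (h : ∀ u : M, (∀ r ∈ maximalIdeal R, r • u = 0) → u = 0) :
    ∃ z ∈ maximalIdeal R, IsSMulRegular M z := by
  have hsub : Subsingleton ((R ⧸ maximalIdeal R) →ₗ[R] M) := by
    refine subsingleton_of_forall_eq 0 fun f ↦ ?_
    have h1 : f 1 = 0 := h _ fun r hr ↦ by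
      have : r • (1 : R ⧸ maximalIdeal R) = 0 := by
        rw [Algebra.smul_def, mul_one]
        exact Ideal.Quotient.eq_zero_iff_mem.mpr hr
      rw [← map_smul, this, map_zero]
    refine LinearMap.ext fun a ↦ ?_
    obtain ⟨a, rfl⟩ := Ideal.Quotient.mk_surjective a
    have : Ideal.Quotient.mk (maximalIdeal R) a = a • 1 := by
      rw [Algebra.smul_def, mul_one]; rfl
    rw [this, map_smul, h1, smul_zero, LinearMap.zero_apply]
  obtain ⟨z, hz, hreg⟩ := IsSMulRegular.subsingleton_linearMap_iff.mp hsub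
  exact ⟨z, by rwa [Ideal.annihilator_quotient] at hz, hreg⟩

/-- Dividing out a regular element lowers the depth by at most one. -/
theorem exists_isWeaklyRegular_quotSMulTop (n : ℕ) {M : Type*} [AddCommGroup M] [Module R M]
    [Module.Finite R M] (rs : List R) (hlen : rs.length = n + 1)
    (hmem : ∀ r ∈ rs, r ∈ maximalIdeal R) (hrs : IsWeaklyRegular M rs)
    (y : R) (hy : y ∈ maximalIdeal R) (hreg : IsSMulRegular M y) :
    ∃ ss : List R, ss.length = n ∧ (∀ s ∈ ss, s ∈ maximalIdeal R) ∧
      IsWeaklyRegular (QuotSMulTop y M) ss := by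
  induction n generalizing M rs y with
  | zero => exact ⟨[], rfl, by simp, .nil _ _⟩
  | succ n ih =>
    match rs, hlen with
    | a :: b :: rs, hlen =>
    simp only [List.mem_cons, forall_eq_or_imp] at hmem
    obtain ⟨ha, hb, hmem⟩ := hmem
    rw [isWeaklyRegular_cons_iff] at hrs
    obtain ⟨hareg, hrs⟩ := hrs
    have hbreg : IsSMulRegular (QuotSMulTop a M) b := ((isWeaklyRegular_cons_iff _ _ _).mp hrs).1
    have hsa := hbreg.eq_zero_of_forall_mem_smul hb
    have hsy := QuotSMulTop.eq_zero_of_forall_smul_eq_zero hareg hreg ha hsa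
    -- Regularity on the product gives one z for both quotients. It links a to y: the sequence is
    -- exchanged first modulo z on M/aM, then modulo y on M/zM.
    obtain ⟨z, hz, hzreg⟩ : ∃ z ∈ maximalIdeal R,
        IsSMulRegular (QuotSMulTop a M × QuotSMulTop y M) z := by
      refine exists_isSMulRegular_mem_maximalIdeal fun u hu ↦ Prod.ext ?_ ?_
      · exact hsa _ fun r hr ↦ congrArg Prod.fst (hu r hr)
      · exact hsy _ fun r hr ↦ congrArg Prod.snd (hu r hr)
    have hza : IsSMulRegular (QuotSMulTop a M) z :=
      hzreg.of_injective (LinearMap.inl R _ _) LinearMap.inl_injective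
    have hzy : IsSMulRegular (QuotSMulTop y M) z :=
      hzreg.of_injective (LinearMap.inr R _ _) LinearMap.inr_injective
    obtain ⟨bs, hbs, hbsm, hbsr⟩ := ih (b :: rs) (by simpa using hlen)
      (by simpa using ⟨hb, hmem⟩) hrs z hz hza
    have h1 : IsWeaklyRegular M (z :: a :: bs) :=
      isWeaklyRegular_of_perm_of_subset_maximalIdeal (rs := a :: z :: bs)
        (by simpa using ⟨hareg, hza, hbsr⟩) (.swap _ _ _) (by simpa using ⟨ha, hz, hbsm⟩)
    have h2 : IsWeaklyRegular M [z, y] :=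
      isWeaklyRegular_of_perm_of_subset_maximalIdeal (rs := [y, z])
        (by simpa using ⟨hreg, hzy⟩) (.swap _ _ _) (by simpa using ⟨hy, hz⟩)
    simp only [isWeaklyRegular_cons_iff] at h2
    obtain ⟨cs, hcs, hcsm, hcsr⟩ := ih (a :: bs) (by simpa using hbs)
      (by simpa using ⟨ha, hbsm⟩) ((isWeaklyRegular_cons_iff _ _ _).mp h1).2 y hy h2.2.1
    have h3 : IsWeaklyRegular M (y :: z :: cs) :=
      isWeaklyRegular_of_perm_of_subset_maximalIdeal (rs := z :: y :: cs)
        (by simpa using ⟨h2.1, h2.2.1, hcsr⟩) (.swap _ _ _) (by simpa using ⟨hz, hy, hcsm⟩)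
    exact ⟨z :: cs, by simpa using hcs, by simpa using ⟨hz, hcsm⟩,
      ((isWeaklyRegular_cons_iff _ _ _).mp h3).2⟩

end Depth

/-! ### Length inequalities -/

section Length

variable {R : Type*} [CommRing R]

/-- Each factor of the finite filtration by the images of f ^ k is a quotient of M / f(M). -/
theorem Module.length_ne_top_of_isNilpotent {M : Type*} [AddCommGroup M] [Module R M]
    (f : Module.End R M) (hf : IsNilpotent f)
    (h : Module.length R (M ⧸ LinearMap.range f) ≠ ⊤) : Module.length R M ≠ ⊤ := by
  obtain ⟨n, hn⟩ := hf
  have hstep : ∀ k, Module.length R (LinearMap.range (f ^ (k + 1))) ≠ ⊤ →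
      Module.length R (LinearMap.range (f ^ k)) ≠ ⊤ := by
    intro k hk
    have hle : LinearMap.range (f ^ (k + 1)) ≤ LinearMap.range (f ^ k) := by
      rw [pow_succ]; exact LinearMap.range_comp_le_range _ _
    let A := (LinearMap.range (f ^ (k + 1))).submoduleOf (LinearMap.range (f ^ k))
    have hA : Module.length R A ≠ ⊤ := by
      rwa [(Submodule.submoduleOfEquivOfLe hle).length_eq]
    let g : M →ₗ[R] LinearMap.range (f ^ k) ⧸ A := A.mkQ ∘ₗ (f ^ k).rangeRestrict
    have hg : LinearMap.range f ≤ LinearMap.ker g := by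
      rintro _ ⟨m, rfl⟩
      rw [LinearMap.mem_ker]
      refine (Submodule.Quotient.mk_eq_zero _).mpr ?_
      change (f ^ k) (f m) ∈ LinearMap.range (f ^ (k + 1))
      exact ⟨m, by rw [pow_succ]; rfl⟩
    have hsurj : Function.Surjective ((LinearMap.range f).liftQ g hg) := by
      rw [← LinearMap.range_eq_top, Submodule.range_liftQ, LinearMap.range_eq_top]
      exact A.mkQ_surjective.comp (LinearMap.surjective_rangeRestrict _)
    have hq := Module.length_le_of_surjective _ hsurj
    rw [Module.length_eq_add_of_exact A.subtype A.mkQ A.subtype_injective A.mkQ_surjective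
      (LinearMap.exact_subtype_mkQ A)]
    exact WithTop.add_ne_top.mpr ⟨hA, fun htop ↦ h (top_le_iff.mp (htop ▸ hq))⟩
  have hbase : Module.length R (LinearMap.range (f ^ n)) ≠ ⊤ := by
    rw [hn, LinearMap.range_zero, Module.length_bot]
    exact ENat.zero_ne_top
  have hzero : Module.length R (LinearMap.range (f ^ 0)) ≠ ⊤ :=
    Nat.decreasingInduction (motive := fun k _ ↦ Module.length R (LinearMap.range (f ^ k)) ≠ ⊤)
      (fun k _ hk ↦ hstep k hk) hbase (Nat.zero_le n)
  rwa [pow_zero, Module.End.one_eq_id, LinearMap.range_id, Module.length_top] at hzero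

theorem Module.length_ker_eq_length_quotient_range {M : Type*} [AddCommGroup M] [Module R M]
    (f : Module.End R M) (h : Module.length R M ≠ ⊤) :
    Module.length R (LinearMap.ker f) = Module.length R (M ⧸ LinearMap.range f) := by
  have h1 := Module.length_eq_add_of_exact (LinearMap.ker f).subtype f.rangeRestrict
    (Submodule.subtype_injective _) f.surjective_rangeRestrict
    (by rw [LinearMap.exact_iff, LinearMap.ker_rangeRestrict, Submodule.range_subtype])
  have h2 := Module.length_eq_add_of_exact (LinearMap.range f).subtype (LinearMap.range f).mkQ
    (Submodule.subtype_injective _) (Submodule.mkQ_surjective _) (LinearMap.exact_subtype_mkQ _)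
  rw [h2, add_comm] at h1
  have hr : Module.length R (LinearMap.range f) ≠ ⊤ := fun htop ↦ h (by rw [h2, htop, top_add])
  exact WithTop.add_right_cancel hr h1.symm

/-- For an endomorphism of a Noetherian module, the kernel is at most as long as the cokernel. -/
theorem Module.length_ker_le_length_quotient_range {M : Type*} [AddCommGroup M] [Module R M]
    [IsNoetherian R M] (f : Module.End R M) :
    Module.length R (LinearMap.ker f) ≤ Module.length R (M ⧸ LinearMap.range f) := by
  by_cases htop : Module.length R (M ⧸ LinearMap.range f) = ⊤
  · exact htop ▸ le_top
  obtain ⟨n, hn⟩ := monotone_stabilizes_iff_noetherian.mpr ‹IsNoetherian R M› f.iterateKer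
  have hn1 : LinearMap.ker (f ^ (n + 1)) = LinearMap.ker (f ^ n) := (hn (n + 1) (by omega)).symm
  have hker : LinearMap.ker f ≤ LinearMap.ker (f ^ n) := by
    rw [← hn1, pow_succ]; exact LinearMap.ker_le_ker_comp _ _
  -- On this stable kernel f is nilpotent, and T ∩ f(M) = f(T), so T / f(T) embeds in M / f(M).
  -- Hence T has finite length, where kernel and cokernel are equally long.
  let T := LinearMap.ker (f ^ n)
  have hT : ∀ m ∈ T, f m ∈ T := fun m hm ↦ by
    change (f ^ n) (f m) = 0
    have : (f ^ (n + 1)) m = 0 := by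
      rw [← LinearMap.mem_ker, hn1]; exact hm
    rwa [pow_succ] at this
  let g : Module.End R T := f.restrict hT
  have hgpow : ∀ k (t : T), ((g ^ k) t : M) = (f ^ k) t := by
    intro k
    induction k with
    | zero => intro t; rfl
    | succ k ih => intro t; rw [pow_succ, pow_succ]; exact ih (g t)
  have hnil : IsNilpotent g := ⟨n, LinearMap.ext fun t ↦ Subtype.ext ((hgpow n t).trans t.2)⟩
  have hcomap : LinearMap.range g = (LinearMap.range f).comap T.subtype := by
    ext t
    refine ⟨fun ⟨s, hs⟩ ↦ ⟨s, congrArg Subtype.val hs⟩, fun ⟨m, hm⟩ ↦ ?_⟩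
    have hmT : m ∈ T := by
      change m ∈ LinearMap.ker (f ^ n)
      rw [← hn1, LinearMap.mem_ker, pow_succ]
      change (f ^ n) (f m) = 0
      rw [hm]; exact t.2
    exact ⟨⟨m, hmT⟩, Subtype.ext hm⟩
  have hinj : Function.Injective
      ((LinearMap.range g).mapQ (LinearMap.range f) T.subtype hcomap.le) := by
    rw [← LinearMap.ker_eq_bot, Submodule.ker_mapQ, ← hcomap, Submodule.mkQ_map_self]
  have hle := Module.length_le_of_injective _ hinj
  have hfin : Module.length R T ≠ ⊤ :=
    Module.length_ne_top_of_isNilpotent g hnil fun h ↦ htop (top_le_iff.mp (h ▸ hle))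
  let ι : LinearMap.ker f →ₗ[R] LinearMap.ker g :=
    ((Submodule.inclusion hker).codRestrict (LinearMap.ker g) fun m ↦ Subtype.ext m.2)
  have hι : Function.Injective ι := fun a b hab ↦
    Subtype.ext (congrArg (fun c : LinearMap.ker g ↦ ((c : T) : M)) hab)
  calc Module.length R (LinearMap.ker f) ≤ Module.length R (LinearMap.ker g) :=
        Module.length_le_of_injective ι hι
    _ = Module.length R (T ⧸ LinearMap.range g) := Module.length_ker_eq_length_quotient_range g hfin
    _ ≤ _ := hle

theorem LinearMap.range_lsmul_eq_smul_top {M : Type*} [AddCommGroup M] [Module R M] (x : R) :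
    LinearMap.range (LinearMap.lsmul R M x) = x • (⊤ : Submodule R M) := by
  ext m
  simp [Submodule.mem_smul_pointwise_iff_exists]

/-- The length of `N / xN` is monotone in the submodule `N`. -/
theorem Module.length_quotSMulTop_submodule_le {M : Type*} [AddCommGroup M] [Module R M]
    [IsNoetherian R M] (N : Submodule R M) (x : R) :
    Module.length R (QuotSMulTop x N) ≤ Module.length R (QuotSMulTop x M) := by
  let φ := QuotSMulTop.map x N.subtype
  let ψ := QuotSMulTop.map x N.mkQ
  let e := LinearMap.lsmul R (M ⧸ N) x
  have hψ : Function.Surjective ψ := QuotSMulTop.map_surjective x N.mkQ_surjective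
  have hex : Function.Exact φ ψ :=
    QuotSMulTop.map_exact x (LinearMap.exact_subtype_mkQ N) N.mkQ_surjective
  have hN := Module.length_eq_add_of_exact (LinearMap.ker φ).subtype φ.rangeRestrict
    (Submodule.subtype_injective _) φ.surjective_rangeRestrict
    (by rw [LinearMap.exact_iff, LinearMap.ker_rangeRestrict, Submodule.range_subtype])
  have hM := Module.length_eq_add_of_exact (LinearMap.range φ).subtype ψ
    (Submodule.subtype_injective _) hψ
    (by rw [LinearMap.exact_iff, Submodule.range_subtype]; exact LinearMap.exact_iff.mp hex)
  -- The snake map, read backwards: A surjects onto both kernels, and `b` kills `ker c` = N.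
  let A : Submodule R M := N.comap (LinearMap.lsmul R M x)
  let a : A →ₗ[R] N := ((LinearMap.lsmul R M x).restrict (fun _ h ↦ h))
  let b : A →ₗ[R] LinearMap.ker φ :=
    ((x • (⊤ : Submodule R N)).mkQ ∘ₗ a).codRestrict _ fun m ↦ by
      rw [LinearMap.mem_ker]
      refine (Submodule.Quotient.mk_eq_zero _).mpr ?_
      exact Submodule.smul_mem_pointwise_smul _ _ _ trivial
  have hb : Function.Surjective b := by
    rintro ⟨u, hu⟩
    obtain ⟨v, rfl⟩ := Submodule.Quotient.mk_surjective _ u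
    rw [LinearMap.mem_ker] at hu
    have hv : (v : M) ∈ x • (⊤ : Submodule R M) := (Submodule.Quotient.mk_eq_zero _).mp hu
    obtain ⟨m, -, hm⟩ := (Submodule.mem_smul_pointwise_iff_exists _ _ _).mp hv
    have hmA : m ∈ A := by
      change x • m ∈ N
      exact hm ▸ v.2
    have hv : a ⟨m, hmA⟩ = v := Subtype.ext hm
    exact ⟨⟨m, hmA⟩, Subtype.ext (congrArg (x • (⊤ : Submodule R N)).mkQ hv)⟩
  let c : A →ₗ[R] LinearMap.ker e :=
    (N.mkQ ∘ₗ A.subtype).codRestrict _ fun m ↦ by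
      rw [LinearMap.mem_ker]
      exact (Submodule.Quotient.mk_eq_zero _).mpr m.2
  have hc : Function.Surjective c := by
    rintro ⟨u, hu⟩
    obtain ⟨m, rfl⟩ := Submodule.Quotient.mk_surjective _ u
    exact ⟨⟨m, (Submodule.Quotient.mk_eq_zero N).mp hu⟩, rfl⟩
  have hcb : LinearMap.ker c ≤ LinearMap.ker b := by
    rintro ⟨m, hm⟩ hmc
    have hmN : m ∈ N := (Submodule.Quotient.mk_eq_zero N).mp (congrArg Subtype.val hmc)
    refine Subtype.ext ((Submodule.Quotient.mk_eq_zero _).mpr ?_)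
    exact Submodule.smul_mem_pointwise_smul (⟨m, hmN⟩ : N) x ⊤ trivial
  have hker : Module.length R (LinearMap.ker φ) ≤ Module.length R (LinearMap.ker e) := by
    rw [← (c.quotKerEquivOfSurjective hc).length_eq]
    refine Module.length_le_of_surjective ((LinearMap.ker c).liftQ b hcb) ?_
    rw [← LinearMap.range_eq_top, Submodule.range_liftQ, LinearMap.range_eq_top]
    exact hb
  have hQ := Module.length_ker_le_length_quotient_range e
  rw [LinearMap.range_lsmul_eq_smul_top] at hQ
  rw [hN, hM, add_comm]
  exact add_le_add_right (hker.trans hQ) _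

/-- N/𝔪N is a quotient of N/xN, and its dimension is μ(N). -/
theorem Submodule.spanFinrank_le_length_quotSMulTop [IsLocalRing R] [IsNoetherianRing R]
    {M : Type*} [AddCommGroup M] [Module R M] [Module.Finite R M] (N : Submodule R M)
    {x : R} (hx : x ∈ maximalIdeal R) :
    (N.spanFinrank : ℕ∞) ≤ Module.length R (QuotSMulTop x N) := by
  let : Field (R ⧸ maximalIdeal R) := Ideal.Quotient.field _
  rw [IsLocalRing.spanFinrank_eq_finrank_quotient N (IsNoetherian.noetherian N),
    ← Module.length_eq_finrank,
    ← Module.length_eq_of_surjective (S := R) Ideal.Quotient.mk_surjective]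
  have hle : x • (⊤ : Submodule R N) ≤ maximalIdeal R • (⊤ : Submodule R N) := by
    rw [← Submodule.ideal_span_singleton_smul]
    exact Submodule.smul_mono_left ((Ideal.span_singleton_le_iff_mem _).mpr hx)
  exact Module.length_le_of_surjective (Submodule.factor hle) (Submodule.factor_surjective hle)

end Length

theorem exists_isWeaklyRegular_of_le_moduleDepth {R M : Type*} [CommRing R] [IsLocalRing R] [AddCommGroup M] [Module R M]
    (n : ℕ) (h : (n : ℕ∞) ≤ moduleDepth R M) :
    ∃ rs : List R, rs.length = n ∧ (∀ r ∈ rs, r ∈ maximalIdeal R) ∧ IsWeaklyRegular M rs := by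
  rcases subsingleton_or_nontrivial M with hM | hM
  -- On the zero module every sequence is weakly regular.
  · refine ⟨List.replicate n 0, by simp, fun r hr ↦ ?_, ?_⟩
    · rw [List.eq_of_mem_replicate hr]
      exact Ideal.zero_mem _
    · exact (isWeaklyRegular_iff _ _).mpr fun i hi ↦ Function.injective_of_subsingleton _
  · rw [moduleDepth, if_neg (not_subsingleton M)] at h
    obtain ⟨rs, hrs, hn⟩ : ∃ rs : List R, ((∀ r ∈ rs, r ∈ maximalIdeal R) ∧ IsRegular M rs) ∧
        n ≤ rs.length := by
      by_contra! hlt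
      rcases n with _ | n
      · exact absurd (hlt [] ⟨by simp, .nil _ _⟩) (by simp)
      · have hle : (⨆ (rs : List R) (_ : (∀ r ∈ rs, r ∈ maximalIdeal R) ∧ IsRegular M rs),
            (rs.length : ℕ∞)) ≤ n :=
          iSup₂_le fun rs hrs ↦ by exact_mod_cast Nat.lt_succ_iff.mp (hlt rs hrs)
        have : n + 1 ≤ n := by exact_mod_cast h.trans hle
        omega
    refine ⟨rs.take n, by simpa using hn, fun r hr ↦ hrs.1 r (List.mem_of_mem_take hr), ?_⟩
    have := hrs.2.toIsWeaklyRegular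
    rw [← List.take_append_drop n rs, isWeaklyRegular_append_iff] at this
    exact this.1

theorem Ideal.ofList_add_cons {R : Type*} [CommRing R] (x j : R) (xs : List R) (hj : j ∈ Ideal.ofList xs) :
    Ideal.ofList ((x + j) :: xs) = Ideal.ofList (x :: xs) := by
  simp only [Ideal.ofList_cons]
  refine le_antisymm (sup_le ?_ le_sup_right) (sup_le ?_ le_sup_right) <;>
    rw [Ideal.span_singleton_le_iff_mem]
  · exact Ideal.add_mem _ (Ideal.mem_sup_left (Ideal.mem_span_singleton_self x))
      (Ideal.mem_sup_right hj)
  · simpa using Ideal.sub_mem _ (Ideal.mem_sup_left (Ideal.mem_span_singleton_self (x + j)))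
      (Ideal.mem_sup_right hj)

/-! ### Reduction modulo a regular element and the induction -/

section MainArgument

variable {R : Type*} [CommRing R] [IsLocalRing R] [IsNoetherianRing R]

/-- A parameter ideal of `M` lies in no associated prime of a module of positive depth whose
annihilator contains that of `M`. -/
theorem not_le_of_mem_associatedPrimes {M Q : Type*} [AddCommGroup M] [Module R M]
    [Module.Finite R M] [AddCommGroup Q] [Module R Q] {I : Ideal R}
    (hI : IsFiniteLength R (M ⧸ (I • (⊤ : Submodule R M))))
    (hann : Module.annihilator R M ≤ Module.annihilator R Q)
    {a : R} (ha : a ∈ maximalIdeal R) (hreg : IsSMulRegular Q a)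
    {P : Ideal R} (hP : P ∈ associatedPrimes R Q) : ¬ I ≤ P := by
  intro hIP
  have hprime : P.IsPrime := IsAssociatedPrime.isPrime hP
  have hMP : Module.annihilator R M ≤ P := hann.trans
    (Submodule.annihilator_top (R := R) (M := Q) ▸ IsAssociatedPrime.annihilator_le hP)
  -- P contains the annihilator of M/IM, which contains a power of a by finite length; but P
  -- consists of zero divisors on Q.
  have hsupp : (⟨P, hprime⟩ : PrimeSpectrum R) ∈
      Module.support R (M ⧸ (I • (⊤ : Submodule R M))) := by
    rw [Module.support_quotient]
    exact ⟨Module.mem_support_iff_of_finite.mpr hMP, hIP⟩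
  have hle := Module.mem_support_iff_of_finite.mp hsupp
  have := (isFiniteLength_iff_isNoetherian_isArtinian.mp hI).2
  obtain ⟨n, hn⟩ := IsArtinian.range_smul_pow_stabilizes (M ⧸ (I • (⊤ : Submodule R M))) a
  have hbot : a ^ n • (⊤ : Submodule R (M ⧸ (I • (⊤ : Submodule R M)))) = ⊥ := by
    refine Submodule.eq_bot_of_le_smul_of_le_jacobson_bot (Ideal.span {a}) _
      (IsNoetherian.noetherian _) ?_ ((Ideal.span_singleton_le_iff_mem _).mpr
        (maximalIdeal_le_jacobson _ ha))
    have := hn (n + 1) (Nat.le_succ n)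
    rw [Submodule.ideal_span_singleton_smul, smul_smul, ← pow_succ',
      ← LinearMap.range_lsmul_eq_smul_top, ← LinearMap.range_lsmul_eq_smul_top]
    exact this.le
  have hmem : a ^ n ∈ P := hle <| Module.mem_annihilator.mpr fun m ↦ by
    have := Submodule.smul_mem_pointwise_smul m (a ^ n)
      (⊤ : Submodule R (M ⧸ (I • (⊤ : Submodule R M)))) trivial
    rwa [hbot, Submodule.mem_bot] at this
  have haP : a ∈ ⋃ p ∈ associatedPrimes R Q, (p : Set R) :=
    Set.mem_iUnion₂.mpr ⟨P, hP, hprime.mem_of_pow_mem _ hmem⟩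
  rw [biUnion_associatedPrimes_eq_compl_regular] at haP
  exact haP hreg

/-- Reducing modulo an element regular on `M / N` does not lower the number of generators of `N`. -/
theorem Submodule.spanFinrank_le_spanFinrank_map_mkQ {M : Type*} [AddCommGroup M] [Module R M]
    [Module.Finite R M] (N : Submodule R M) {y : R} (hy : y ∈ maximalIdeal R)
    (hreg : IsSMulRegular (M ⧸ N) y) :
    N.spanFinrank ≤ (N.map (y • (⊤ : Submodule R M)).mkQ).spanFinrank := by
  classical
  obtain ⟨s, hs, hspan⟩ := Submodule.FG.exists_span_finset_card_eq_spanFinrank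
    (IsNoetherian.noetherian (N.map (y • (⊤ : Submodule R M)).mkQ))
  have hlift : ∀ u : QuotSMulTop y M, u ∈ s → ∃ v ∈ N, Submodule.Quotient.mk v = u :=
    fun u hu ↦ (hspan ▸ Submodule.subset_span hu : u ∈ N.map (y • (⊤ : Submodule R M)).mkQ)
  choose! v hvN hv using hlift
  let t := s.image v
  have htN : span R (t : Set M) ≤ N := span_le.mpr fun w hw ↦ by
    obtain ⟨u, hu, rfl⟩ := Finset.mem_image.mp hw
    exact hvN u hu
  have hmap : N.map (y • (⊤ : Submodule R M)).mkQ ≤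
      (span R (t : Set M)).map (y • (⊤ : Submodule R M)).mkQ := by
    rw [← hspan]
    refine span_le.mpr fun u hu ↦ ⟨v u, subset_span ?_, hv u hu⟩
    exact Finset.mem_image_of_mem v hu
  have hle : N ≤ span R (t : Set M) := by
    refine Submodule.le_of_le_smul_of_le_jacobson_bot (I := Ideal.span {y})
      (IsNoetherian.noetherian N) ((Ideal.span_singleton_le_iff_mem _).mpr
        (maximalIdeal_le_jacobson _ hy)) fun n hn ↦ ?_
    obtain ⟨w, hw, hwn⟩ := hmap ⟨n, hn, rfl⟩
    have hsub : n - w ∈ y • (⊤ : Submodule R M) := (Submodule.Quotient.eq _).mp hwn.symm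
    have := smul_top_inf_eq_smul_of_isSMulRegular_on_quot hreg ⟨hsub, N.sub_mem hn (htN hw)⟩
    rw [Submodule.ideal_span_singleton_smul, ← add_sub_cancel w n]
    exact Submodule.add_mem_sup hw this
  rw [← hs, le_antisymm hle htN]
  refine (Submodule.spanFinrank_span_le_ncard_of_finite t.finite_toSet).trans ?_
  rw [Set.ncard_coe_finset]
  exact Finset.card_image_le

/-- The quotient of `M / yM` by the image of `N` is the reduction of `M / N` modulo `y`. -/
noncomputable def QuotSMulTop.quotientMapMkQEquiv {R M : Type*} [CommRing R] [AddCommGroup M]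
    [Module R M] (y : R) (N : Submodule R M) :
    (QuotSMulTop y M ⧸ N.map (y • (⊤ : Submodule R M)).mkQ) ≃ₗ[R] QuotSMulTop y (M ⧸ N) :=
  Submodule.quotientQuotientEquivQuotientSup _ _ ≪≫ₗ
    Submodule.quotEquivOfEq _ _ (sup_comm _ _) ≪≫ₗ
    (Submodule.quotientQuotientEquivQuotientSup _ _).symm ≪≫ₗ
    Submodule.quotEquivOfEq _ _
      (by rw [Submodule.map_pointwise_smul, Submodule.map_top, Submodule.range_mkQ])

/-- No dimension is assumed, so M/yM qualifies for induction at once. The regular sequence is one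
shorter than `x :: xs`, leaving the last parameter for the base case. -/
theorem Submodule.spanFinrank_le_length_quotient_ofList {M : Type*} [AddCommGroup M]
    [Module R M] [Module.Finite R M] (N : Submodule R M) (x : R) (xs : List R)
    (hx : ∀ r ∈ x :: xs, r ∈ maximalIdeal R)
    (hdepth : ∃ rs : List R, rs.length = xs.length ∧ (∀ r ∈ rs, r ∈ maximalIdeal R) ∧
      IsWeaklyRegular (M ⧸ N) rs) :
    (N.spanFinrank : ℕ∞) ≤
      Module.length R (M ⧸ (Ideal.ofList (x :: xs) • (⊤ : Submodule R M))) := by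
  induction xs generalizing M x with
  | nil =>
    have h := (N.spanFinrank_le_length_quotSMulTop (hx x (by simp))).trans
      (Module.length_quotSMulTop_submodule_le N x)
    rwa [Ideal.ofList_singleton, Submodule.ideal_span_singleton_smul]
  | cons x' xs ih =>
    by_cases htop : Module.length R
        (M ⧸ (Ideal.ofList (x :: x' :: xs) • (⊤ : Submodule R M))) = ⊤
    · exact htop ▸ le_top
    obtain ⟨rs, hlen, hmem, hrs⟩ := hdepth
    obtain ⟨a, rs', rfl⟩ := List.exists_cons_of_length_eq_add_one hlen
    have hareg : IsSMulRegular (M ⧸ N) a := ((isWeaklyRegular_cons_iff _ _ _).mp hrs).1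
    have hann : Module.annihilator R M ≤ Module.annihilator R (M ⧸ N) :=
      LinearMap.annihilator_le_of_surjective N.mkQ N.mkQ_surjective
    obtain ⟨j, hj, hreg⟩ := exists_isSMulRegular_add (M := M ⧸ N) x (Ideal.ofList (x' :: xs))
      fun P hP hxP hle ↦ not_le_of_mem_associatedPrimes (Module.length_ne_top_iff.mp htop) hann
        (hmem a (by simp)) hareg hP <| by
          rw [Ideal.ofList_cons]
          exact sup_le ((Ideal.span_singleton_le_iff_mem _).mpr hxP) hle
    have hxs : ∀ r ∈ x' :: xs, r ∈ maximalIdeal R := fun r hr ↦ hx r (List.mem_cons_of_mem _ hr)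
    have hy : x + j ∈ maximalIdeal R :=
      Ideal.add_mem _ (hx x (by simp)) (Ideal.span_le.mpr hxs hj)
    obtain ⟨ss, hss, hssm, hssr⟩ :=
      exists_isWeaklyRegular_quotSMulTop xs.length (a :: rs') hlen hmem hrs _ hy hreg
    have hmap := ih (M := QuotSMulTop (x + j) M)
      (N.map ((x + j) • (⊤ : Submodule R M)).mkQ) x' hxs
      ⟨ss, hss, hssm, ((QuotSMulTop.quotientMapMkQEquiv _ N).isWeaklyRegular_congr ss).mpr hssr⟩
    rw [← Ideal.ofList_add_cons x j (x' :: xs) hj,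
      (Submodule.quotOfListConsSMulTopEquivQuotSMulTopInner M (x + j) (x' :: xs)).length_eq]
    exact le_trans (by exact_mod_cast N.spanFinrank_le_spanFinrank_map_mkQ hy hreg) hmap

end MainArgument

theorem corollary4 {R : Type*} [CommRing R] [IsLocalRing R] [IsNoetherianRing R]
    {M : Type*} [AddCommGroup M] [Module R M] [Module.Finite R M]
    (d : ℕ) (hd : 1 ≤ d) (hdim : Module.supportDim R M = d)
    (q : Ideal R)
    (hq : ∃ x : Fin d → R, IsSystemOfParameters R M x ∧ q = Ideal.span (Set.range x))
    (N : Submodule R M) (hN : ((d - 1 : ℕ) : ℕ∞) ≤ moduleDepth R (M ⧸ N)) :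
    (N.spanFinrank : ℕ∞) ≤ Module.length R (M ⧸ (q • (⊤ : Submodule R M))) := by
  obtain ⟨x, hx, rfl⟩ := hq
  obtain ⟨n, rfl⟩ := Nat.exists_eq_add_of_le' hd
  have hspan : Ideal.span (Set.range x) = Ideal.ofList (x 0 :: List.ofFn fun i ↦ x i.succ) := by
    rw [← List.ofFn_succ, Ideal.ofList]
    congr 1
    ext r
    exact List.mem_ofFn.symm
  rw [hspan]
  refine N.spanFinrank_le_length_quotient_ofList _ _ (fun r hr ↦ ?_) ?_
  · rw [← List.ofFn_succ, List.mem_ofFn] at hr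
    obtain ⟨i, rfl⟩ := hr
    exact hx.mem_maximalIdeal i
  · rw [List.length_ofFn]
    exact exists_isWeaklyRegular_of_le_moduleDepth n hN
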